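/- Let $X$ be an uncountable standard Borel space equipped with a nonzero $\sigma$-finite non-atomic Borel measure $\mu$. Let $L^0(X,U(1))$ be the group of $\mu$-a.e. equivalence classes of measurable functions from $X$ to the circle group $U(1)$ under pointwise multiplication, with the topology of convergence in measure (on every set of finite measure, if $\mu(X)=\infty$). By a topological factor-group of a topological group $A$ we mean $A/F$ with the quotient topology, where $F$ is a closed normal subgroup of $A$, and isomorphisms are those of topological groups. **Corollary.** Every abelian Polish group $G$ is isomorphic to a closed subgroup of a topological factor-group of $L^0(X,U(1))$; that is, there are a closed subgroup $F$ of $L^0(X,U(1))$ and a closed subgroup $K$ of $L^0(X,U(1))/F$ such that $G\cong K$ as topological groups. Moreover (companion corollary), $G$ is isomorphic to a topological factor-group of a closed subgroup of $L^0(X,U(1))$; that is, there are a closed subgroup $H$ of $L^0(X,U(1))$ and a closed subgroup $N$ of $H$ such that $G\cong H/N$ as topological groups. -/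

import Mathlib

open MeasureTheory Filter
open scoped Topology Pointwise ENNReal

/-- `L⁰(X, U(1))`: the group of `μ`-a.e. equivalence classes of (strongly) measurable functions
`X → U(1)` with pointwise multiplication. -/
abbrev L0Circle {X : Type*} [MeasurableSpace X] (μ : Measure X) : Type _ := X →ₘ[μ] Circle

namespace L0Circle

variable {X : Type*} [MeasurableSpace X] (μ : Measure X)

/-- The set of all `f` with `μ {x ∈ A : |f x - 1| ≥ ε} < ε`. -/
def nhd (A : Set X) (ε : ℝ) : Set (L0Circle μ) :=
  {f | μ (A ∩ {x | ε ≤ dist (f x) 1}) < ENNReal.ofReal ε}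

theorem circle_dist_eq (a b : Circle) : dist a b = ‖(a : ℂ) - b‖ := by
  rw [← dist_eq_norm]; rfl

theorem circle_dist_mul (a b : Circle) : dist (a * b) 1 ≤ dist a 1 + dist b 1 := by
  simp only [circle_dist_eq, Circle.coe_mul, Circle.coe_one]
  calc ‖(a : ℂ) * b - 1‖ = ‖(a : ℂ) * (b - 1) + (a - 1)‖ := by ring_nf
    _ ≤ ‖(a : ℂ) * (b - 1)‖ + ‖(a : ℂ) - 1‖ := norm_add_le _ _
    _ = ‖(a : ℂ) - 1‖ + ‖(b : ℂ) - 1‖ := by rw [norm_mul, Circle.norm_coe]; ring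

theorem circle_dist_inv_mul (a b : Circle) : dist (a⁻¹ * b) 1 = dist b a := by
  simp only [circle_dist_eq, Circle.coe_mul, Circle.coe_one]
  have h : (a : ℂ) * ((a⁻¹ : Circle) : ℂ) = 1 := by
    rw [← Circle.coe_mul, mul_inv_cancel, Circle.coe_one]
  have h2 : (b : ℂ) - a = a * (((a⁻¹ : Circle) : ℂ) * b - 1) := by
    linear_combination (-(b : ℂ)) * h
  rw [h2, norm_mul, Circle.norm_coe, one_mul]

theorem circle_dist_inv (a : Circle) : dist a⁻¹ 1 = dist a 1 := by
  simpa [dist_comm] using circle_dist_inv_mul a 1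

theorem nhd_anti {A A' : Set X} {ε ε' : ℝ} (hA : A ⊆ A') (hε : ε' ≤ ε) :
    nhd μ A' ε' ⊆ nhd μ A ε := by
  intro f hf
  refine lt_of_le_of_lt (measure_mono ?_) (lt_of_lt_of_le hf (ENNReal.ofReal_le_ofReal hε))
  exact fun x hx => ⟨hA hx.1, hε.trans hx.2⟩

/-- The neighbourhoods of `1` are generated by the sets
`{f : μ {x ∈ A : |f x - 1| ≥ ε} < ε}`, where `A` has finite measure and `ε > 0`. -/
@[reducible]
noncomputable def filterBasis : GroupFilterBasis (L0Circle μ) :=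
  groupFilterBasisOfComm
    {U | ∃ A : Set X, MeasurableSet A ∧ μ A < ∞ ∧ ∃ ε : ℝ, 0 < ε ∧ U = nhd μ A ε}
    ⟨_, ∅, MeasurableSet.empty, by simp, 1, one_pos, rfl⟩
    (by
      rintro _ _ ⟨A, hA, hA', ε, hε, rfl⟩ ⟨B, hB, hB', δ, hδ, rfl⟩
      refine ⟨_, ⟨A ∪ B, hA.union hB, measure_union_lt_top hA' hB', min ε δ,
        lt_min hε hδ, rfl⟩, Set.subset_inter ?_ ?_⟩
      · exact nhd_anti μ Set.subset_union_left (min_le_left _ _)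
      · exact nhd_anti μ Set.subset_union_right (min_le_right _ _))
    (by
      rintro _ ⟨A, hA, hA', ε, hε, rfl⟩
      have h0 : μ (A ∩ {x | ε ≤ dist ((1 : L0Circle μ) x) 1}) = 0 := by
        refine measure_mono_null Set.inter_subset_right ?_
        have h := AEEqFun.coeFn_one (μ := μ) (β := Circle)
        refine measure_mono_null ?_ (ae_iff.1 h)
        intro x hx h1
        simp only [Set.mem_ofPred_eq, h1, Pi.one_apply, dist_self] at hx
        linarith
      change μ (A ∩ {x | ε ≤ dist ((1 : L0Circle μ) x) 1}) < ENNReal.ofReal ε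
      rw [h0]
      exact ENNReal.ofReal_pos.2 hε)
    (by
      rintro _ ⟨A, hA, hA', ε, hε, rfl⟩
      refine ⟨_, ⟨A, hA, hA', ε / 2, half_pos hε, rfl⟩, ?_⟩
      rintro _ ⟨f, hf, g, hg, rfl⟩
      have h := AEEqFun.coeFn_mul f g
      have hle : μ (A ∩ {x | ε ≤ dist ((f * g) x) 1}) ≤
          μ ((A ∩ {x | ε / 2 ≤ dist (f x) 1}) ∪ (A ∩ {x | ε / 2 ≤ dist (g x) 1})) := by
        refine measure_mono_ae ?_
        filter_upwards [h] with x hx hxA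
        obtain ⟨hxA, hxd⟩ := hxA
        simp only [Set.mem_ofPred_eq, hx, Pi.mul_apply] at hxd
        have := circle_dist_mul (f x) (g x)
        by_cases h1 : ε / 2 ≤ dist (f x) 1
        · exact Or.inl ⟨hxA, h1⟩
        · refine Or.inr ⟨hxA, ?_⟩
          simp only [Set.mem_ofPred_eq]
          linarith
      refine lt_of_le_of_lt (hle.trans (measure_union_le _ _)) ?_
      have := ENNReal.add_lt_add hf hg
      rwa [← ENNReal.ofReal_add (half_pos hε).le (half_pos hε).le, add_halves] at this)
    (by
      rintro _ ⟨A, hA, hA', ε, hε, rfl⟩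
      refine ⟨_, ⟨A, hA, hA', ε, hε, rfl⟩, ?_⟩
      intro f hf
      have hle : μ (A ∩ {x | ε ≤ dist ((f⁻¹ : L0Circle μ) x) 1}) ≤
          μ (A ∩ {x | ε ≤ dist (f x) 1}) := by
        refine measure_mono_ae ?_
        filter_upwards [AEEqFun.coeFn_inv f] with x hx hxA
        obtain ⟨hxA, hxd⟩ := hxA
        simp only [Set.mem_ofPred_eq, hx, Pi.inv_apply, circle_dist_inv] at hxd
        exact ⟨hxA, hxd⟩
      exact lt_of_le_of_lt hle hf)

/-- The topology of convergence in measure on `L⁰(X, U(1))` (on sets of finite measure, if `μ` is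
infinite). -/
noncomputable instance instTopologicalSpace : TopologicalSpace (L0Circle μ) := (filterBasis μ).topology

instance instIsTopologicalGroup : IsTopologicalGroup (L0Circle μ) :=
  (filterBasis μ).isTopologicalGroup

/-- Convergence in this topology is convergence in measure on every set of finite measure. -/
theorem tendsto_iff {ι : Type*} {l : Filter ι} {u : ι → L0Circle μ} {f : L0Circle μ} :
    Tendsto u l (𝓝 f) ↔ ∀ A : Set X, MeasurableSet A → μ A < ∞ →
      TendstoInMeasure (μ.restrict A) (fun i => ⇑(u i)) l f := by
  have key : ∀ (i : ι) (A : Set X) (ε : ℝ),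
      μ (A ∩ {x | ε ≤ dist ((f⁻¹ * u i : L0Circle μ) x) 1}) =
        μ (A ∩ {x | ε ≤ dist (u i x) (f x)}) := by
    intro i A ε
    refine measure_congr ?_
    filter_upwards [AEEqFun.coeFn_mul f⁻¹ (u i), AEEqFun.coeFn_inv f] with x h1 h2
    have : dist ((f⁻¹ * u i : L0Circle μ) x) 1 = dist (u i x) (f x) := by
      rw [h1, Pi.mul_apply, h2, Pi.inv_apply, circle_dist_inv_mul]
    refine propext ⟨fun h => ⟨h.1, ?_⟩, fun h => ⟨h.1, ?_⟩⟩
    · have := h.2; simp_all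
    · have := h.2; simp_all
  have hT : Tendsto u l (𝓝 f) ↔ ∀ A : Set X, MeasurableSet A → μ A < ∞ → ∀ ε : ℝ, 0 < ε →
      ∀ᶠ i in l, μ (A ∩ {x | ε ≤ dist (u i x) (f x)}) < ENNReal.ofReal ε := by
    have hb := (filterBasis μ).nhds_hasBasis f
    refine (hb.tendsto_right_iff).trans ?_
    have hm : ∀ (i : ι) (A : Set X) (ε : ℝ), u i ∈ (fun y => f * y) '' nhd μ A ε ↔
        μ (A ∩ {x | ε ≤ dist (u i x) (f x)}) < ENNReal.ofReal ε := by
      intro i A ε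
      rw [← key]
      constructor
      · rintro ⟨g, hg, h⟩
        rw [← h]
        simpa [nhd] using hg
      · intro h
        exact ⟨f⁻¹ * u i, h, by simp⟩
    constructor
    · intro h A hA hA' ε hε
      simpa only [hm] using h _ ⟨A, hA, hA', ε, hε, rfl⟩
    · rintro h _ ⟨A, hA, hA', ε, hε, rfl⟩
      simpa only [hm] using h A hA hA' ε hε
  rw [hT]
  refine forall_congr' fun A => forall_congr' fun hA => forall_congr' fun hA' => ?_
  rw [tendstoInMeasure_iff_dist]
  simp only [Measure.restrict_apply' hA]
  constructor
  · intro h ε hε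
    rw [ENNReal.tendsto_nhds_zero]
    intro δ hδ
    by_cases hδt : δ = ∞
    · simp [hδt]
    have hδ' : 0 < δ.toReal := ENNReal.toReal_pos hδ.ne' hδt
    filter_upwards [h (min ε δ.toReal) (lt_min hε hδ')] with i hi
    refine le_trans (measure_mono ?_) (hi.le.trans (ENNReal.ofReal_le_of_le_toReal
      (min_le_right _ _)))
    exact fun x hx => ⟨hx.2, le_trans (min_le_left ε δ.toReal) (show ε ≤ _ from hx.1)⟩
  · intro h ε hε
    have := (h ε hε).eventually (gt_mem_nhds (ENNReal.ofReal_pos.2 hε))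
    simpa only [Set.inter_comm] using this

/-- For a finite measure, convergence in this topology is convergence in measure. -/
theorem tendsto_iff_tendstoInMeasure [IsFiniteMeasure μ] {ι : Type*} {l : Filter ι}
    {u : ι → L0Circle μ} {f : L0Circle μ} :
    Tendsto u l (𝓝 f) ↔ TendstoInMeasure μ (fun i => ⇑(u i)) l f := by
  rw [tendsto_iff]
  constructor
  · intro h
    simpa using h Set.univ MeasurableSet.univ (measure_lt_top _ _)
  · intro h A hA _ ε hε
    exact tendsto_of_tendsto_of_tendsto_of_le_of_le tendsto_const_nhds (h ε hε)
      (fun _ => zero_le) (fun _ => Measure.restrict_apply_le _ _)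

end L0Circle

/-!
The theorem reduces to one construction: a closed subgroup `H` of `L⁰(X, U(1))` together with a
continuous open surjective homomorphism `φ : H → G` (`L0Circle.exists_isOpenQuotientMap`). Then
`G ≅ H / ker φ`, and since `H` is saturated for `F = ker φ`, viewed as a closed subgroup of
`L⁰(X, U(1))`, the group `H / F` is also a closed subgroup of `L⁰(X, U(1)) / F`
(`subquotient_of_isOpenQuotientMap`).

The construction parallels the proof that every separable Banach space is a quotient of `ℓ¹`.
The topology of `G` is given by an invariant length `ℓ` (`exists_length_hasBasis_nhds_one`), and `G`
is complete as a uniform group (`completeSpace_of_polishSpace`). Let `a₀, a₁, …` be dense in `G`.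
On a probability space equivalent to `(X, μ)` there are independent `U(1)`-valued random variables
`z₀, z₁, …` with `E[zₛⁿ] = exp (-|n| ℓ(aₛ))` (`exists_circle_variables`), so that an integer vector
`x` of finite support satisfies `E[∏ zₛ ^ xₛ] = exp (-∑ |xₛ| ℓ(aₛ))`. The law of a single `zₛ` is
the image of the uniform measure on the circle under the Möbius map `z ↦ (z + r) / (1 + r z)`, whose
powers have mean `rⁿ` by the mean value property; independent copies live on a product space, into
which any atomless standard probability space maps in a measure-preserving way.

If `∏ zₛ ^ xₛ` is close to `1` in measure, its expectation is close to `1`, hence `∑ |xₛ| ℓ(aₛ)` is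
small, hence `∏ aₛ ^ xₛ` is close to `1` in `G`. Therefore `∏ zₛ ^ xₛ ↦ ∏ aₛ ^ xₛ` extends to a
continuous homomorphism `φ` on the closure `H` of the group generated by the `zₛ`
(`exists_continuous_extension_topologicalClosure`). Conversely, an element `g` of small length is an
infinite product of elements `aₛ` whose lengths decrease geometrically (`exists_seq_tendsto_prod`).
The corresponding product of the `zₛ` converges almost everywhere
(`L0Circle.exists_tendsto_prod_of_summable_gauge`) to a preimage of `g` close to `1`, so `φ` is open
and surjective.
-/

/-! ### Abelian Polish groups: invariant lengths, completeness, extension of homomorphisms -/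

/-- The topology of a first countable abelian topological group is given by an invariant length
function, namely `ℓ g = sup_h min 1 (d h (h * g))` for any pseudometric `d` inducing the group
uniformity. -/
theorem exists_length_hasBasis_nhds_one (G : Type*) [CommGroup G] [TopologicalSpace G]
    [IsTopologicalGroup G] [FirstCountableTopology G] :
    ∃ ℓ : G → ℝ, ℓ 1 = 0 ∧ (∀ g h, ℓ (g * h) ≤ ℓ g + ℓ h) ∧ (∀ g, ℓ g⁻¹ = ℓ g) ∧
      (𝓝 (1 : G)).HasBasis (fun ε : ℝ => 0 < ε) fun ε => {g | ℓ g < ε} := by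
  let : UniformSpace G := IsTopologicalGroup.rightUniformSpace G
  have : IsUniformGroup G := isUniformGroup_of_commGroup
  have : (uniformity G).IsCountablyGenerated := by
    rw [uniformity_eq_comap_nhds_one G]; infer_instance
  let : PseudoMetricSpace G := UniformSpace.pseudoMetricSpace G
  have hbdd : ∀ g : G, BddAbove (Set.range fun h : G => min 1 (dist h (h * g))) := fun g =>
    ⟨1, by rintro _ ⟨h, rfl⟩; exact min_le_left _ _⟩
  have hle : ∀ g h : G, min 1 (dist h (h * g)) ≤ ⨆ h : G, min 1 (dist h (h * g)) := fun g h =>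
    le_ciSup (hbdd g) h
  refine ⟨fun g => ⨆ h : G, min 1 (dist h (h * g)), by simp, fun g k => ?_, fun g => ?_, ?_⟩
  · refine ciSup_le fun h => ?_
    have h1 := hle g h
    have h2 := hle k (h * g)
    have h3 := dist_triangle h (h * g) (h * g * k)
    rw [← mul_assoc]
    have h4 : (0 : ℝ) ≤ dist h (h * g) := dist_nonneg
    have h5 : (0 : ℝ) ≤ dist (h * g) (h * g * k) := dist_nonneg
    refine le_trans ?_ (add_le_add h1 h2)
    rcases le_total 1 (dist h (h * g)) with a | a <;>
    rcases le_total 1 (dist (h * g) (h * g * k)) with b | b <;>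
    simp only [a, b, min_eq_left, min_eq_right] <;>
    first
      | exact (min_le_left _ _).trans (by linarith)
      | exact (min_le_right _ _).trans (by linarith)
  · refine (Equiv.mulRight g⁻¹).iSup_congr fun h => ?_
    simp [dist_comm]
  · rw [hasBasis_iff]
    intro t
    constructor
    · intro ht
      obtain ⟨ε, hε, hεt⟩ := Metric.mem_nhds_iff.1 ht
      refine ⟨min 1 ε, lt_min one_pos hε, fun g hg => hεt ?_⟩
      have h1 := (hle g 1).trans_lt hg
      rw [one_mul] at h1
      rw [Metric.mem_ball, dist_comm]
      by_contra h
      exact absurd h1 (not_lt.2 (min_le_min_left _ (not_lt.1 h)))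
    · rintro ⟨ε, hε, hεt⟩
      have hu := Metric.dist_mem_uniformity (α := G) (half_pos hε)
      rw [uniformity_eq_comap_nhds_one G] at hu
      obtain ⟨V, hV, hVt⟩ := hu
      refine mem_of_superset hV fun g hg => hεt ?_
      refine lt_of_le_of_lt (ciSup_le fun h => ?_) (half_lt_self hε)
      have : ((h, h * g) : G × G) ∈ {p : G × G | dist p.1 p.2 < ε / 2} := hVt (by simpa using hg)
      exact (min_le_right _ _).trans (le_of_lt this)

/-- For a sequence that is Cauchy in the group uniformity and any compatible pseudometric `d`,
there are points `a` in every nonempty open set such that the translates `u n * a'`, for `a'` near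
`a` and `n` large, stay within `d`-distance `ε` of each other. This is the density statement to
which the Baire category theorem is applied in `completeSpace_of_polishSpace`. -/
theorem exists_translate_small_dist {G : Type*} [CommGroup G] [UniformSpace G]
    [IsUniformGroup G] (d : PseudoMetricSpace G)
    (hd : d.toUniformSpace.toTopologicalSpace = UniformSpace.toTopologicalSpace)
    {u : ℕ → G} (hu : CauchySeq u) {W : Set G} (hW : IsOpen W) (hne : W.Nonempty) {ε : ℝ}
    (hε : 0 < ε) :
    ∃ V : Set G, IsOpen V ∧ (V ∩ W).Nonempty ∧
      ∃ N, ∀ a ∈ V, ∀ n ≥ N, ∀ m ≥ N, d.dist (u n * a) (u m * a) < ε := by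
  obtain ⟨w, hw⟩ := hne
  have hcauchy : ∀ U ∈ 𝓝 (1 : G), ∃ N, ∀ m ≥ N, ∀ n ≥ N, u m / u n ∈ U := by
    intro U hU
    have := cauchySeq_iff.1 hu {p | p.2 / p.1 ∈ U} (by
      rw [uniformity_eq_comap_nhds_one G]; exact preimage_mem_comap hU)
    obtain ⟨N, hN⟩ := this
    exact ⟨N, fun m hm n hn => hN n hn m hm⟩
  have h1 : {v : G | v * w ∈ W} ∈ 𝓝 (1 : G) :=
    (continuous_mul_const w).continuousAt.preimage_mem_nhds
      (by simpa using hW.mem_nhds hw)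
  obtain ⟨N, hN⟩ := hcauchy _ h1
  -- A neighbourhood of `p = u N * w` is `d`-small, and the centre `(u K)⁻¹ * p` of `V` is chosen so
  -- that `u n` carries `V` into that neighbourhood for all `n ≥ K`.
  set p := u N * w with hp
  have h2 : {v : G | d.dist (p * v) p < ε / 2} ∈ 𝓝 (1 : G) := by
    have hb : @Metric.ball G d p (ε / 2) ∈ 𝓝 p := by
      have := @Metric.ball_mem_nhds G d p _ (half_pos hε)
      rwa [hd] at this
    exact (continuous_const_mul p).continuousAt.preimage_mem_nhds
      (by rwa [mul_one])
  obtain ⟨T, hTo, hT1, hT⟩ := exists_open_nhds_one_mul_subset h2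
  obtain ⟨M, hM⟩ := hcauchy T (hTo.mem_nhds hT1)
  set K := max M N
  have key : ∀ a : G, a * (p⁻¹ * u K) ∈ T → ∀ n ≥ K, d.dist (u n * a) p < ε / 2 := by
    intro a ha n hn
    have := hT (Set.mul_mem_mul (hM n ((le_max_left _ _).trans hn) K (le_max_left _ _)) ha)
    have e : p * (u n / u K * (a * (p⁻¹ * u K))) = u n * a := by
      have aux : ∀ b c e f x y : G, b * x = 1 → e * y = 1 → b * (c * y * (f * (x * e))) = c * f :=
        fun b c e f x y h h' => by
          calc _ = c * f * (b * x) * (e * y) := by ac_rfl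
            _ = _ := by rw [h, h', mul_one, mul_one]
      rw [div_eq_mul_inv]
      exact aux _ _ _ _ _ _ (mul_inv_cancel _) (mul_inv_cancel _)
    simpa only [Set.mem_ofPred_eq, e] using this
  refine ⟨(fun a => a * (p⁻¹ * u K)) ⁻¹' T, hTo.preimage (continuous_mul_const _),
    ⟨(u K)⁻¹ * p, ?_, ?_⟩, K, fun a ha n hn m hm => ?_⟩
  · have e : (u K)⁻¹ * p * (p⁻¹ * u K) = 1 := by group
    simpa only [Set.mem_preimage, e] using hT1
  · have := hN N le_rfl K (le_max_right _ _)
    have e : (u K)⁻¹ * p = u N / u K * w := by rw [hp, div_eq_mul_inv]; ac_rfl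
    rw [e]; exact this
  · have a1 := key a ha n hn
    have a2 := key a ha m hm
    have a3 := d.dist_triangle (u n * a) p (u m * a)
    rw [d.dist_comm p] at a3
    linarith

/-- An abelian Polish group is complete in its group uniformity. Given a Cauchy sequence `u`, the
Baire category theorem provides `a` such that `u n * a` is Cauchy for a complete compatible metric.
-/
theorem completeSpace_of_polishSpace (G : Type*) [CommGroup G] [UniformSpace G]
    [IsUniformGroup G] [PolishSpace G] : CompleteSpace G := by
  have : (uniformity G).IsCountablyGenerated := by
    rw [uniformity_eq_comap_nhds_one G]; infer_instance
  refine UniformSpace.complete_of_cauchySeq_tendsto fun u hu => ?_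
  obtain ⟨d, hd, hc⟩ := TopologicalSpace.IsCompletelyMetrizableSpace.complete (X := G)
  let O : ℕ → Set G := fun k => ⋃₀ {V | IsOpen V ∧
    ∃ N, ∀ a ∈ V, ∀ n ≥ N, ∀ m ≥ N, d.dist (u n * a) (u m * a) < 1 / ((k : ℝ) + 1)}
  have hO : ∀ k, IsOpen (O k) := fun k => isOpen_sUnion fun V hV => hV.1
  have hD : ∀ k, Dense (O k) := fun k => by
    rw [dense_iff_inter_open]
    intro W hW hne
    obtain ⟨V, hV, ⟨a, haV, haW⟩, hN⟩ := exists_translate_small_dist d.toPseudoMetricSpace hd hu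
      hW hne (ε := 1 / ((k : ℝ) + 1)) (by positivity)
    exact ⟨a, haW, V, ⟨hV, hN⟩, haV⟩
  obtain ⟨a, ha⟩ := (dense_iInter_of_isOpen_nat hO hD).nonempty
  have hcs : @CauchySeq G ℕ d.toUniformSpace _ fun n => u n * a := by
    rw [@Metric.cauchySeq_iff G ℕ d.toPseudoMetricSpace]
    intro ε hε
    obtain ⟨k, hk⟩ := exists_nat_one_div_lt hε
    obtain ⟨V, ⟨-, N, hN⟩, haV⟩ := Set.mem_iInter.1 ha k
    exact ⟨N, fun m hm n hn => (hN a haV m hm n hn).trans hk⟩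
  obtain ⟨b, hb⟩ := @cauchySeq_tendsto_of_complete G ℕ d.toUniformSpace _ hc _ hcs
  rw [hd] at hb
  refine ⟨b * a⁻¹, ?_⟩
  simpa using hb.mul_const a⁻¹

/-- A homomorphism `φ₀` from `D` to an abelian Polish group that is continuous at `1` for the group
topology pulled back along `Ψ : D →* L` factors through `Ψ` and extends continuously to the closure
of the range of `Ψ`. -/
theorem exists_continuous_extension_topologicalClosure {L D G : Type*} [CommGroup L]
    [TopologicalSpace L] [IsTopologicalGroup L] [CommGroup D] [CommGroup G] [TopologicalSpace G]
    [IsTopologicalGroup G] [PolishSpace G] (Ψ : D →* L) (φ₀ : D →* G)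
    (h : Tendsto φ₀ (comap Ψ (𝓝 1)) (𝓝 1)) :
    ∃ φ : Ψ.range.topologicalClosure →* G, Continuous φ ∧
      ∀ x (hx : Ψ x ∈ Ψ.range.topologicalClosure), φ ⟨Ψ x, hx⟩ = φ₀ x := by
  set H := Ψ.range.topologicalClosure
  have hmem : ∀ x, Ψ x ∈ H := fun x => subset_closure ⟨x, rfl⟩
  let i : D →* H := Ψ.codRestrict H hmem
  let : TopologicalSpace D := TopologicalSpace.induced i inferInstance
  have : IsTopologicalGroup D := topologicalGroup_induced i
  have hi : IsDenseInducing i := by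
    refine ⟨⟨rfl⟩, fun y => ?_⟩
    have : closure (Subtype.val ⁻¹' (Set.range Ψ) : Set H) = Set.univ := by
      refine Set.eq_univ_of_forall fun y => ?_
      rw [closure_subtype]
      refine closure_mono ?_ y.2
      rintro _ ⟨x, rfl⟩
      exact ⟨⟨_, hmem x⟩, ⟨x, rfl⟩, rfl⟩
    have h2 : Set.range i = (Subtype.val ⁻¹' (Set.range Ψ) : Set H) := by
      ext y
      constructor
      · rintro ⟨x, rfl⟩; exact ⟨x, rfl⟩
      · rintro ⟨x, hx⟩; exact ⟨x, Subtype.ext hx⟩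
    rw [h2, this]; trivial
  let : UniformSpace D := IsTopologicalGroup.rightUniformSpace D
  have : IsUniformGroup D := isUniformGroup_of_commGroup
  let : UniformSpace H := IsTopologicalGroup.rightUniformSpace H
  have : IsUniformGroup H := isUniformGroup_of_commGroup
  let : UniformSpace G := IsTopologicalGroup.rightUniformSpace G
  have : IsUniformGroup G := isUniformGroup_of_commGroup
  have : CompleteSpace G := completeSpace_of_polishSpace G
  have hu : UniformContinuous φ₀ := by
    refine uniformContinuous_of_tendsto_one ?_
    have : 𝓝 (1 : D) = comap Ψ (𝓝 1) := by
      rw [hi.isInducing.nhds_eq_comap, map_one, nhds_subtype, comap_comap]; rfl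
    rwa [this]
  have hui : IsUniformInducing i := MonoidHom.isUniformInducing_of_isInducing hi.isInducing
  have hc : Continuous (hi.extend φ₀) :=
    (uniformContinuous_uniformly_extend hui hi.dense hu).continuous
  have he : ∀ x, hi.extend φ₀ (i x) = φ₀ x := fun x => hi.extend_eq hu.continuous x
  refine ⟨MonoidHom.mk' (hi.extend φ₀) fun a b => ?_, hc, fun x hx => he x⟩
  refine hi.dense.induction_on₂ (p := fun a b => hi.extend φ₀ (a * b) =
    hi.extend φ₀ a * hi.extend φ₀ b) ?_ (fun x y => ?_) a b
  · exact isClosed_eq (hc.comp continuous_mul)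
      ((hc.comp continuous_fst).mul (hc.comp continuous_snd))
  · rw [← map_mul, he, he, he, map_mul]

/-! ### Quotients of closed subgroups and closed subgroups of quotients -/

theorem nonempty_continuousMulEquiv_of_ker_eq {H G K : Type*} [Group H] [TopologicalSpace H]
    [Group G] [TopologicalSpace G] [Group K] [TopologicalSpace K] {φ : H →* G} {ψ : H →* K}
    (hφ : IsOpenQuotientMap φ) (hψ : IsOpenQuotientMap ψ) (h : φ.ker = ψ.ker) :
    Nonempty (G ≃ₜ* K) := by
  let e : G ≃* K := ((QuotientGroup.quotientKerEquivOfSurjective φ hφ.surjective).symm.trans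
    (QuotientGroup.quotientMulEquivOfEq h)).trans
      (QuotientGroup.quotientKerEquivOfSurjective ψ hψ.surjective)
  have he : ∀ x, e (φ x) = ψ x := fun x => by
    have : (QuotientGroup.quotientKerEquivOfSurjective φ hφ.surjective).symm (φ x) =
      (x : H ⧸ φ.ker) := by rw [MulEquiv.symm_apply_eq]; rfl
    simp only [e, MulEquiv.trans_apply, this]
    rfl
  refine ⟨e.toContinuousMulEquiv fun s => ?_⟩
  rw [← hφ.isQuotientMap.isOpen_preimage, ← hψ.isQuotientMap.isOpen_preimage, ← Set.preimage_comp]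
  have : ⇑e ∘ φ = ψ := funext he
  rw [this]

/-- If `G` is an open continuous quotient of a closed subgroup of `L`, then `G` is both a quotient
of a closed subgroup of `L` and a closed subgroup of a quotient of `L`. -/
theorem subquotient_of_isOpenQuotientMap {L G : Type*} [CommGroup L] [TopologicalSpace L]
    [IsTopologicalGroup L] [CommGroup G] [TopologicalSpace G] [T1Space G] {H : Subgroup L}
    (hH : IsClosed (H : Set L)) {φ : H →* G} (hφ : IsOpenQuotientMap φ) :
    (∃ F : Subgroup L, IsClosed (F : Set L) ∧ ∃ K : Subgroup (L ⧸ F),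
      IsClosed (K : Set (L ⧸ F)) ∧ Nonempty (G ≃ₜ* K)) ∧
    (∃ H : Subgroup L, IsClosed (H : Set L) ∧ ∃ N : Subgroup H, IsClosed (N : Set H) ∧
      Nonempty (G ≃ₜ* (H ⧸ N))) := by
  have hker : IsClosed (φ.ker : Set H) := by
    have : (φ.ker : Set H) = φ ⁻¹' {1} := rfl
    rw [this]
    exact isClosed_singleton.preimage hφ.continuous
  refine ⟨?_, H, hH, φ.ker, hker, nonempty_continuousMulEquiv_of_ker_eq (ψ := QuotientGroup.mk' _)
    hφ QuotientGroup.isOpenQuotientMap_mk (by simp)⟩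
  set F : Subgroup L := φ.ker.map H.subtype with hF
  have hFH : F ≤ H := by rintro _ ⟨x, -, rfl⟩; exact x.2
  have hmemF : ∀ x : H, (x : L) ∈ F ↔ x ∈ φ.ker := fun x => by
    constructor
    · rintro ⟨y, hy, hyx⟩; rwa [← Subtype.ext (a1 := y) (a2 := x) hyx]
    · exact fun hx => ⟨x, hx, rfl⟩
  have hsat : ∀ x : L, (x : L ⧸ F) ∈ H.map (QuotientGroup.mk' F) ↔ x ∈ H := fun x => by
    constructor
    · rintro ⟨y, hy, hyx⟩
      have := hFH (QuotientGroup.eq.1 hyx)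
      simpa using H.mul_mem hy this
    · exact fun hx => ⟨x, hx, rfl⟩
  refine ⟨F, ?_, H.map (QuotientGroup.mk' F), ?_, ?_⟩
  · exact hH.isClosedEmbedding_subtypeVal.isClosedMap _ hker
  · rw [← (QuotientGroup.isQuotientMap_mk F).isClosed_preimage]
    convert hH using 1
    ext x; exact hsat x
  · refine nonempty_continuousMulEquiv_of_ker_eq
      (ψ := (QuotientGroup.mk' F).subgroupMap H) hφ ⟨?_, ?_, ?_⟩ ?_
    · exact MonoidHom.subgroupMap_surjective _ _
    · exact (QuotientGroup.continuous_mk.comp continuous_subtype_val).subtype_mk _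
    · intro O hO
      obtain ⟨O', hO', rfl⟩ := isOpen_induced_iff.1 hO
      refine isOpen_induced_iff.2 ⟨_, QuotientGroup.isOpenMap_coe O' hO', ?_⟩
      ext ⟨y, hy⟩
      constructor
      · rintro ⟨x, hx, rfl⟩
        exact ⟨⟨x, (hsat x).1 hy⟩, hx, rfl⟩
      · rintro ⟨x, hx, hxy⟩
        exact ⟨x, hx, congrArg Subtype.val hxy⟩
    · ext x
      rw [← hmemF, MonoidHom.mem_ker, ← QuotientGroup.eq_one_iff, Subtype.ext_iff]
      rfl

/-! ### Circle-valued random variables with prescribed Fourier coefficients -/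

theorem norm_add_ofReal_eq_norm_one_add_mul (z : Circle) (r : ℝ) :
    ‖(z : ℂ) + r‖ = ‖1 + r * (z : ℂ)‖ := by
  have h : (1 : ℂ) + r * z = z * (starRingEnd ℂ) (z + r) := by
    rw [map_add, Complex.conj_ofReal, mul_add, Complex.mul_conj, Circle.normSq_coe]
    push_cast
    ring
  rw [h, norm_mul, Circle.norm_coe, one_mul, Complex.norm_conj]

theorem one_add_ofReal_mul_ne_zero {r : ℝ} (h0 : 0 ≤ r) (h1 : r < 1) {z : ℂ} (hz : ‖z‖ ≤ 1) :
    1 + (r : ℂ) * z ≠ 0 := by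
  intro h
  have h2 : (r : ℂ) * z = -1 := by linear_combination h
  have h3 := congrArg norm h2
  rw [norm_mul, norm_neg, norm_one, Complex.norm_real, Real.norm_of_nonneg h0] at h3
  nlinarith [norm_nonneg z]

/-- The mean value property: the average of a holomorphic function over the unit circle is its
value at the origin, and the Möbius map `z ↦ (z + r) / (1 + r z)` sends `0` to `r`. -/
theorem circleAverage_moebius_pow {r : ℝ} (h0 : 0 ≤ r) (h1 : r < 1) (n : ℕ) :
    Real.circleAverage (fun z : ℂ => ((z + r) / (1 + r * z)) ^ n) 0 1 = (r : ℂ) ^ n := by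
  have : DiffContOnCl ℂ (fun z : ℂ => ((z + r) / (1 + r * z)) ^ n) (Metric.ball 0 |1|) := by
    refine DifferentiableOn.diffContOnCl fun z hz => ?_
    rw [abs_one, closure_ball _ one_ne_zero, mem_closedBall_zero_iff] at hz
    refine DifferentiableAt.differentiableWithinAt ?_
    have := one_add_ofReal_mul_ne_zero h0 h1 hz
    fun_prop (disch := assumption)
  rw [this.circleAverage]
  simp

/-- The uniform probability measure on the interval `(0, 2π]`. -/
noncomputable def uniformAngle : Measure ℝ :=
  ENNReal.ofReal (2 * Real.pi)⁻¹ • volume.restrict (Set.Ioc 0 (2 * Real.pi))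

instance : IsProbabilityMeasure uniformAngle := ⟨by
  simp only [uniformAngle, Measure.smul_apply, Measure.restrict_apply_univ, Real.volume_Ioc,
    sub_zero, smul_eq_mul]
  rw [← ENNReal.ofReal_mul (by positivity), inv_mul_cancel₀ (by positivity), ENNReal.ofReal_one]⟩

/-- There is a circle-valued random variable whose Fourier coefficients are `r ^ |n|`. For `r < 1`
it is the Möbius map `z ↦ (z + r) / (1 + r z)` evaluated at a uniform point of the circle. -/
theorem exists_continuous_integral_zpow {r : ℝ} (h0 : 0 ≤ r) (h1 : r ≤ 1) :
    ∃ T : ℝ → Circle, Continuous T ∧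
      ∀ n : ℤ, ∫ θ, (T θ : ℂ) ^ n ∂uniformAngle = (r : ℂ) ^ n.natAbs := by
  rcases h1.eq_or_lt with rfl | h1
  · exact ⟨fun _ => 1, continuous_const, fun n => by simp⟩
  have hne : ∀ θ : ℝ, 1 + (r : ℂ) * (Circle.exp θ : ℂ) ≠ 0 := fun θ =>
    one_add_ofReal_mul_ne_zero h0 h1 (Circle.norm_coe _).le
  let T : ℝ → Circle := fun θ =>
    ⟨((Circle.exp θ : ℂ) + r) / (1 + r * (Circle.exp θ : ℂ)), mem_sphere_zero_iff_norm.2 (by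
      rw [norm_div, norm_add_ofReal_eq_norm_one_add_mul, div_self (norm_ne_zero_iff.2 (hne θ))])⟩
  have hT : Continuous T := by
    refine Continuous.subtype_mk (Continuous.div ?_ ?_ hne) _ <;> fun_prop
  have hnat : ∀ n : ℕ, ∫ θ, (T θ : ℂ) ^ n ∂uniformAngle = (r : ℂ) ^ n := fun n => by
    rw [← circleAverage_moebius_pow h0 h1 n, Real.circleAverage_def,
      intervalIntegral.integral_of_le (by positivity), uniformAngle, integral_smul_measure,
      ENNReal.toReal_ofReal (by positivity)]
    simp [T, circleMap, Circle.coe_exp]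
  refine ⟨T, hT, fun n => ?_⟩
  obtain ⟨k, rfl | rfl⟩ := n.eq_nat_or_neg
  · simpa using hnat k
  · have : ∀ z : Circle, (z : ℂ) ^ (-(k : ℤ)) = (starRingEnd ℂ) ((z : ℂ) ^ k) := fun z => by
      rw [map_pow, ← Circle.coe_inv_eq_conj, Circle.coe_inv, zpow_neg, zpow_natCast, inv_pow]
    simp_rw [this]
    rw [integral_conj, hnat]
    simp

/-- The distribution function of an atomless law on `ℝ` is uniformly distributed on `[0, 1]` under
that law. -/
theorem measure_setOf_cdf_le (ρ : Measure ℝ) [IsProbabilityMeasure ρ] (hρ : ∀ x, ρ {x} = 0)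
    {t : ℝ} (h0 : 0 ≤ t) (h1 : t ≤ 1) :
    ρ {x | ProbabilityTheory.cdf ρ x ≤ t} = ENNReal.ofReal t := by
  set c := ProbabilityTheory.cdf ρ with hcd
  have hm : Monotone c := ProbabilityTheory.monotone_cdf ρ
  have hc : Continuous c := by
    rw [continuous_iff_continuousAt]
    intro a
    have h := c.measure_singleton a
    rw [hcd, ProbabilityTheory.measure_cdf, hρ, eq_comm, ENNReal.ofReal_eq_zero, sub_nonpos] at h
    rw [hm.continuousAt_iff_leftLim_eq_rightLim, c.rightLim_eq]
    exact le_antisymm (hm.leftLim_le le_rfl) h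
  rcases h1.eq_or_lt with rfl | h1
  · have : {x | c x ≤ 1} = Set.univ := Set.eq_univ_of_forall (ProbabilityTheory.cdf_le_one ρ)
    rw [this]; simp
  set S := {x | c x ≤ t}
  have hS : IsClosed S := isClosed_le hc continuous_const
  have hb : BddAbove S := by
    obtain ⟨y, hy⟩ := ((ProbabilityTheory.tendsto_cdf_atTop ρ).eventually_const_lt h1).exists
    exact ⟨y, fun x hx => (hm.reflect_lt (lt_of_le_of_lt hx hy)).le⟩
  rcases S.eq_empty_or_nonempty with he | hne
  · have : t ≤ 0 := by
      by_contra! h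
      obtain ⟨y, hy⟩ := ((ProbabilityTheory.tendsto_cdf_atBot ρ).eventually_lt_const h).exists
      exact Set.eq_empty_iff_forall_notMem.1 he y hy.le
    rw [he, measure_empty, ENNReal.ofReal_of_nonpos this]
  · have hy : c (sSup S) ≤ t := hS.csSup_mem hne hb
    have hSI : S = Set.Iic (sSup S) :=
      Set.Subset.antisymm (fun x hx => le_csSup hb hx) fun x hx => (hm hx).trans hy
    have hy' : t ≤ c (sSup S) := by
      have : Tendsto c (𝓝[>] (sSup S)) (𝓝 (c (sSup S))) := hc.continuousAt.continuousWithinAt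
      refine ge_of_tendsto this ?_
      filter_upwards [self_mem_nhdsWithin] with x hx
      by_contra! h
      exact absurd (le_csSup hb (show x ∈ S from h.le)) (not_le.2 hx)
    rw [hSI, ← ProbabilityTheory.ofReal_cdf, ← hcd, le_antisymm hy hy']

theorem exists_measurable_map_eq_volume_unitInterval {X : Type*} [MeasurableSpace X]
    [StandardBorelSpace X] (ν : Measure X) [IsProbabilityMeasure ν] [NullSingletonClass ν] :
    ∃ f : X → unitInterval, Measurable f ∧ ν.map f = volume := by
  have he := measurableEmbedding_embeddingReal X
  set ρ := ν.map (embeddingReal X) with hρ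
  have : IsProbabilityMeasure ρ := Measure.isProbabilityMeasure_map he.measurable.aemeasurable
  have hρs : ∀ x, ρ {x} = 0 := fun x => by
    rw [he.map_apply]
    exact (Set.subsingleton_singleton.preimage he.injective).measure_zero _
  have hcm : Measurable (ProbabilityTheory.cdf ρ) := (ProbabilityTheory.monotone_cdf ρ).measurable
  let f : X → unitInterval := fun x => ⟨ProbabilityTheory.cdf ρ (embeddingReal X x),
    ProbabilityTheory.cdf_nonneg _ _, ProbabilityTheory.cdf_le_one _ _⟩
  have hf : Measurable f := (hcm.comp he.measurable).subtype_mk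
  have : IsProbabilityMeasure (ν.map f) := Measure.isProbabilityMeasure_map hf.aemeasurable
  refine ⟨f, hf, Measure.ext_of_Iic _ _ fun t => ?_⟩
  rw [Measure.map_apply hf measurableSet_Iic, unitInterval.volume_Iic,
    ← measure_setOf_cdf_le ρ hρs t.2.1 t.2.2, hρ, he.map_apply]
  rfl

/-- An atomless standard probability space maps in a measure-preserving way into any other standard
probability space. -/
theorem exists_measurable_map_eq {X Y : Type*} [MeasurableSpace X] [StandardBorelSpace X]
    (ν : Measure X) [IsProbabilityMeasure ν] [NullSingletonClass ν]
    [MeasurableSpace Y] [StandardBorelSpace Y] (ρ : Measure Y) [IsProbabilityMeasure ρ] :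
    ∃ f : X → Y, Measurable f ∧ ν.map f = ρ := by
  obtain ⟨f, hf, hfν⟩ := exists_measurable_map_eq_volume_unitInterval ν
  have : Nonempty Y := ρ.nonempty_of_neZero
  obtain ⟨g, hg, hgρ⟩ := ρ.exists_measurable_map_eq
  exact ⟨g ∘ f, hg.comp hf, by rw [← Measure.map_map hg hf, hfν, hgρ]⟩

/-- On an atomless standard probability space there are independent circle-valued random variables
`z s` with Fourier coefficients `exp (-|n| w s)`. Only the resulting mixed moments are recorded. -/
theorem exists_circle_variables {X : Type*} [MeasurableSpace X] [StandardBorelSpace X]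
    (ν : Measure X) [IsProbabilityMeasure ν] [NullSingletonClass ν] {w : ℕ → ℝ}
    (hw : ∀ s, 0 ≤ w s) :
    ∃ z : ℕ → X → Circle, (∀ s, StronglyMeasurable (z s)) ∧ ∀ x : ℕ →₀ ℤ,
      ∫ ω, ((x.prod fun s n => z s ω ^ n : Circle) : ℂ) ∂ν =
        (Real.exp (-x.sum fun s n => |(n : ℝ)| * w s) : ℝ) := by
  choose T hT hTi using fun s => exists_continuous_integral_zpow (Real.exp_pos (-w s)).le
    (Real.exp_le_one_iff.2 (neg_nonpos.2 (hw s)))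
  set P : Measure (ℕ → ℝ) := Measure.infinitePi fun _ => uniformAngle with hP
  obtain ⟨F, hF, hFν⟩ := exists_measurable_map_eq ν P
  refine ⟨fun s ω => T s (F ω s), fun s =>
    (hT s).comp_stronglyMeasurable ((measurable_pi_apply s).comp hF).stronglyMeasurable,
    fun x => ?_⟩
  have hmeas : ∀ s, Measurable fun θ : ℝ => (T s θ : ℂ) ^ x s := fun s => by
    have : Measurable fun θ : ℝ => (T s θ : ℂ) := (continuous_subtype_val.comp (hT s)).measurable
    exact this.pow_const _
  have hprod : ∀ y : ℕ → ℝ, ((x.prod fun s n => T s (y s) ^ n : Circle) : ℂ) =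
      ∏ s : x.support, (T s (y s) : ℂ) ^ x s := fun y => by
    rw [Finset.prod_coe_sort x.support (fun s => (T s (y s) : ℂ) ^ x s), Finsupp.prod]
    exact (map_prod Circle.coeHom _ _).trans
      (Finset.prod_congr rfl fun s _ => Circle.coe_zpow _ _)
  have hind : ProbabilityTheory.iIndepFun
      (fun (s : x.support) (y : ℕ → ℝ) => (T s (y s) : ℂ) ^ x s) P :=
    (ProbabilityTheory.iIndepFun_infinitePi (P := fun _ => uniformAngle)
      (X := fun s (θ : ℝ) => (T s θ : ℂ) ^ x s) hmeas).precomp Subtype.val_injective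
  have hint : ∀ s, ∫ y : ℕ → ℝ, (T s (y s) : ℂ) ^ x s ∂P =
      (Real.exp (-(|(x s : ℝ)| * w s)) : ℝ) := fun s => by
    have := hTi s (x s)
    rw [← Measure.infinitePi_map_eval (fun _ : ℕ => uniformAngle) s,
      integral_map (measurable_pi_apply s).aemeasurable (hmeas s).aestronglyMeasurable] at this
    rw [hP, this, ← Complex.ofReal_pow, ← Real.exp_nat_mul]
    congr 2
    rw [Nat.cast_natAbs, Int.cast_abs]; ring
  have hmeas' : ∀ s : x.support, Measurable fun y : ℕ → ℝ => (T s (y s) : ℂ) ^ x s := fun s =>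
    (hmeas s).comp (measurable_pi_apply (s : ℕ))
  simp_rw [hprod]
  rw [← integral_map (f := fun y : ℕ → ℝ => ∏ s : x.support, (T s (y s) : ℂ) ^ x s) hF.aemeasurable
    (Finset.measurable_fun_prod _ fun s _ => hmeas' s).aestronglyMeasurable, hFν,
    hind.integral_fun_prod_eq_prod_integral fun s => (hmeas' s).aestronglyMeasurable]
  simp_rw [hint]
  rw [Finset.prod_coe_sort x.support
    (fun s => ((Real.exp (-(|(x s : ℝ)| * w s)) : ℝ) : ℂ)), ← Complex.ofReal_prod,
    ← Real.exp_sum, Finset.sum_neg_distrib]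
  rfl

/-! ### Convergence in measure through the mean distance to `1` -/

theorem exists_pos_forall_measure_lt_of_absolutelyContinuous {α : Type*} [MeasurableSpace α]
    {ρ σ : Measure α} [IsFiniteMeasure ρ] [SigmaFinite σ] (h : ρ ≪ σ) {ε : ℝ≥0∞} (hε : ε ≠ 0) :
    ∃ δ > 0, ∀ s, σ s < δ → ρ s < ε := by
  obtain ⟨δ, hδ, H⟩ := exists_pos_setLIntegral_lt_of_measure_lt (μ := σ)
    (Measure.lintegral_rnDeriv_lt_top ρ σ).ne hε
  refine ⟨δ, hδ, fun s hs => ?_⟩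
  rw [← measure_toMeasurable] at hs
  have := H _ hs
  rw [Measure.setLIntegral_rnDeriv h] at this
  exact (measure_mono (subset_toMeasurable _ _)).trans_lt this

namespace L0Circle

variable {X : Type*} [MeasurableSpace X] {μ : Measure X}

/-- The mean distance to `1` with respect to a measure `ν`. It is applied to a probability measure
`ν` with the same null sets as `μ`, for which it describes the topology of `L⁰(X, U(1))`. -/
noncomputable def gauge (ν : Measure X) (f : L0Circle μ) : ℝ := ∫ x, dist (f x) 1 ∂ν

theorem circle_dist_one_le_two (a : Circle) : dist a 1 ≤ 2 := by
  rw [circle_dist_eq]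
  refine (norm_sub_le _ _).trans ?_
  rw [Circle.norm_coe, Circle.coe_one, norm_one]
  norm_num

theorem stronglyMeasurable_dist_one (f : L0Circle μ) : StronglyMeasurable fun x => dist (f x) 1 :=
  f.stronglyMeasurable.dist stronglyMeasurable_const

theorem integrable_dist_one (ν : Measure X) [IsFiniteMeasure ν] (f : L0Circle μ) :
    Integrable (fun x => dist (f x) 1) ν :=
  Integrable.of_bound (stronglyMeasurable_dist_one f).aestronglyMeasurable 2
    (Eventually.of_forall fun x => by
      rw [Real.norm_of_nonneg dist_nonneg]; exact circle_dist_one_le_two _)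

theorem gauge_mul_le {ν : Measure X} [IsFiniteMeasure ν] (hν : ν ≪ μ) (f g : L0Circle μ) :
    gauge ν (f * g) ≤ gauge ν f + gauge ν g := by
  unfold gauge
  rw [← integral_add (integrable_dist_one ν f) (integrable_dist_one ν g)]
  refine integral_mono_ae (integrable_dist_one ν _)
    ((integrable_dist_one ν f).add (integrable_dist_one ν g)) ?_
  filter_upwards [hν.ae_le (AEEqFun.coeFn_mul f g)] with x hx
  rw [hx]
  exact circle_dist_mul _ _

theorem gauge_one {ν : Measure X} (hν : ν ≪ μ) : gauge ν (1 : L0Circle μ) = 0 := by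
  refine integral_eq_zero_of_ae ?_
  filter_upwards [hν.ae_le (AEEqFun.coeFn_one (μ := μ) (β := Circle))] with x hx
  rw [hx]
  simp

theorem gauge_prod_le {ν : Measure X} [IsFiniteMeasure ν] (hν : ν ≪ μ) {ι : Type*} (s : Finset ι)
    (z : ι → L0Circle μ) : gauge ν (∏ k ∈ s, z k) ≤ ∑ k ∈ s, gauge ν (z k) := by
  classical
  induction s using Finset.induction_on with
  | empty => exact (gauge_one hν).le
  | insert a s ha ih =>
    rw [Finset.prod_insert ha, Finset.sum_insert ha]
    exact (gauge_mul_le hν _ _).trans (add_le_add_right ih _)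

theorem setOf_gauge_lt_mem_nhds_one [SigmaFinite μ] {ν : Measure X} [IsProbabilityMeasure ν]
    (hν : ν ≪ μ) {δ : ℝ} (hδ : 0 < δ) : {f : L0Circle μ | gauge ν f < δ} ∈ 𝓝 1 := by
  have h8 : ENNReal.ofReal (δ / 8) ≠ 0 := (ENNReal.ofReal_pos.2 (by linarith)).ne'
  -- The mean distance is at most `ε + 2 ν(B) + 2 ν(Aᶜ)` with `B` the part of `A` on which
  -- `dist (f x) 1 ≥ ε`; this is less than `δ` once `ε ≤ δ / 4` and both measures are below `δ / 8`.
  obtain ⟨η, hη, H⟩ := exists_pos_forall_measure_lt_of_absolutelyContinuous hν h8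
  obtain ⟨A, hA, hAμ, hAν⟩ : ∃ A, MeasurableSet A ∧ μ A < ∞ ∧
      ν Aᶜ < ENNReal.ofReal (δ / 8) := by
    have h1 : Tendsto (fun n => ν (spanningSets μ n)ᶜ) atTop
        (𝓝 (ν (⋂ n, (spanningSets μ n)ᶜ))) := by
      refine tendsto_measure_iInter_atTop
        (fun n => (measurableSet_spanningSets μ n).compl.nullMeasurableSet)
        (fun m n hmn => Set.compl_subset_compl.2 (monotone_spanningSets μ hmn))
        ⟨0, measure_ne_top _ _⟩
    rw [← Set.compl_iUnion, iUnion_spanningSets, Set.compl_univ, measure_empty] at h1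
    obtain ⟨n, hn⟩ := (h1.eventually_lt_const (pos_iff_ne_zero.2 h8)).exists
    exact ⟨_, measurableSet_spanningSets μ n, measure_spanningSets_lt_top μ n, hn⟩
  obtain ⟨ε, hε, hε1, hε2⟩ : ∃ ε : ℝ, 0 < ε ∧ ε ≤ δ / 4 ∧ ENNReal.ofReal ε ≤ η := by
    rcases eq_or_ne η ∞ with rfl | hη'
    · exact ⟨δ / 4, by linarith, le_rfl, le_top⟩
    · refine ⟨min (δ / 4) η.toReal, lt_min (by linarith) (ENNReal.toReal_pos hη.ne' hη'),
        min_le_left _ _, ?_⟩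
      exact ENNReal.ofReal_le_of_le_toReal (min_le_right _ _)
  refine mem_of_superset ((filterBasis μ).nhds_one_hasBasis.mem_of_mem
    (i := nhd μ A ε) ⟨A, hA, hAμ, ε, hε, rfl⟩) fun f hf => ?_
  set B := A ∩ {x | ε ≤ dist (f x) 1} with hB
  have hBm : MeasurableSet B :=
    hA.inter ((stronglyMeasurable_dist_one f).measurable measurableSet_Ici)
  have hBν : ν B < ENNReal.ofReal (δ / 8) := H B (lt_of_lt_of_le hf hε2)
  have hreal : ∀ s : Set X, ν s < ENNReal.ofReal (δ / 8) → ν.real s < δ / 8 := fun s hs => by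
    have := (ENNReal.toReal_lt_toReal (measure_ne_top ν s) ENNReal.ofReal_ne_top).2 hs
    rwa [ENNReal.toReal_ofReal (by linarith)] at this
  have hi1 : Integrable (B.indicator fun _ => (2 : ℝ)) ν :=
    (integrable_const _).indicator hBm
  have hi2 : Integrable (Aᶜ.indicator fun _ => (2 : ℝ)) ν :=
    (integrable_const _).indicator hA.compl
  have hi3 : Integrable (fun x => B.indicator (fun _ => (2 : ℝ)) x +
      Aᶜ.indicator (fun _ => (2 : ℝ)) x) ν := hi1.add hi2
  have hle : gauge ν f ≤ ∫ x, (ε + (B.indicator (fun _ => (2 : ℝ)) x +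
      Aᶜ.indicator (fun _ => (2 : ℝ)) x)) ∂ν := by
    refine integral_mono (integrable_dist_one ν f) ((integrable_const _).add hi3)
      fun x => ?_
    have h2 := circle_dist_one_le_two (f x)
    by_cases hxA : x ∈ A
    · by_cases hxd : ε ≤ dist (f x) 1
      · have hxB : x ∈ B := ⟨hxA, hxd⟩
        simp only [Set.indicator_of_mem hxB, Set.indicator_of_notMem (fun h : x ∈ Aᶜ => h hxA)]
        linarith
      · have hxB : x ∉ B := fun h => hxd h.2
        simp only [Set.indicator_of_notMem hxB, Set.indicator_of_notMem (fun h : x ∈ Aᶜ => h hxA)]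
        linarith
    · have hxB : x ∉ B := fun h => hxA h.1
      simp only [Set.indicator_of_notMem hxB, Set.indicator_of_mem (show x ∈ Aᶜ from hxA)]
      linarith
  rw [integral_add (integrable_const _) hi3, integral_add hi1 hi2,
    integral_indicator_const _ hBm, integral_indicator_const _ hA.compl] at hle
  have h1 := hreal _ hBν
  have h2 := hreal _ hAν
  simp only [integral_const, probReal_univ, smul_eq_mul, one_mul] at hle
  show gauge ν f < δ
  linarith

theorem exists_setOf_gauge_lt_subset_nhd {ν : Measure X} [IsProbabilityMeasure ν]
    (hμ : μ ≪ ν) {A : Set X} (hA : MeasurableSet A) (hAμ : μ A < ∞) {ε : ℝ} (hε : 0 < ε) :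
    ∃ δ > 0, {f : L0Circle μ | gauge ν f < δ} ⊆ nhd μ A ε := by
  have : IsFiniteMeasure (μ.restrict A) := isFiniteMeasure_restrict.2 hAμ.ne
  obtain ⟨η, hη, H⟩ := exists_pos_forall_measure_lt_of_absolutelyContinuous
    (Measure.absolutelyContinuous_of_le (Measure.restrict_le_self (s := A)) |>.trans hμ)
    (ENNReal.ofReal_pos.2 hε).ne'
  obtain ⟨η', hη', hη1⟩ : ∃ η' : ℝ, 0 < η' ∧ ENNReal.ofReal η' ≤ η := by
    rcases eq_or_ne η ∞ with rfl | hη'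
    · exact ⟨1, one_pos, le_top⟩
    · exact ⟨η.toReal, ENNReal.toReal_pos hη.ne' hη', ENNReal.ofReal_toReal_le⟩
  refine ⟨ε * η', by positivity, fun f hf => ?_⟩
  have h1 := mul_meas_ge_le_integral_of_nonneg (μ := ν) (Eventually.of_forall fun x => dist_nonneg)
    (integrable_dist_one ν f) ε
  have h2 : ν.real {x | ε ≤ dist (f x) 1} < η' := by
    by_contra! h
    exact absurd (h1.trans_lt hf) (not_lt.2 (mul_le_mul_of_nonneg_left h hε.le))
  have h3 : ν {x | ε ≤ dist (f x) 1} < η := by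
    refine lt_of_lt_of_le ?_ hη1
    rwa [← ENNReal.ofReal_toReal (measure_ne_top ν {x | ε ≤ dist (f x) 1}),
      ENNReal.ofReal_lt_ofReal_iff hη']
  have h4 := H _ h3
  rw [Measure.restrict_apply' hA, Set.inter_comm] at h4
  exact h4

theorem hasBasis_nhds_one_gauge [SigmaFinite μ] {ν : Measure X} [IsProbabilityMeasure ν]
    (hν : ν ≪ μ) (hμ : μ ≪ ν) :
    (𝓝 (1 : L0Circle μ)).HasBasis (fun δ : ℝ => 0 < δ) fun δ => {f | gauge ν f < δ} := by
  refine ⟨fun t => ⟨fun ht => ?_, fun ⟨δ, hδ, h⟩ =>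
    mem_of_superset (setOf_gauge_lt_mem_nhds_one hν hδ) h⟩⟩
  obtain ⟨_, ⟨A, hA, hAμ, ε, hε, rfl⟩, h⟩ := (filterBasis μ).nhds_one_hasBasis.mem_iff.1 ht
  obtain ⟨δ, hδ, h'⟩ := exists_setOf_gauge_lt_subset_nhd hμ hA hAμ hε
  exact ⟨δ, hδ, h'.trans h⟩

theorem coeFn_prod {ι : Type*} (s : Finset ι) (z : ι → L0Circle μ) :
    ⇑(∏ k ∈ s, z k) =ᵐ[μ] fun x => ∏ k ∈ s, z k x := by
  classical
  induction s using Finset.induction_on with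
  | empty => exact AEEqFun.coeFn_one
  | insert a s ha ih =>
    rw [Finset.prod_insert ha]
    filter_upwards [AEEqFun.coeFn_mul (z a) (∏ k ∈ s, z k), ih] with x h1 h2
    rw [h1, Pi.mul_apply, h2, Finset.prod_insert ha]

/-- An infinite product whose factors have summable mean distance to `1` converges: its partial
products converge almost everywhere, because `∑ dist (z k x) 1` has finite integral. -/
theorem exists_tendsto_prod_of_summable_gauge [SigmaFinite μ] {ν : Measure X}
    [IsProbabilityMeasure ν] (hν : ν ≪ μ) (hμ : μ ≪ ν) {z : ℕ → L0Circle μ}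
    (hz : Summable fun k => gauge ν (z k)) :
    ∃ f : L0Circle μ, Tendsto (fun n => ∏ k ∈ Finset.range n, z k) atTop (𝓝 f) ∧
      gauge ν f ≤ ∑' k, gauge ν (z k) := by
  have hfin : ∀ᵐ x ∂μ, ∑' k, edist (z k x) 1 ≠ ∞ := by
    refine hμ.ae_le ?_
    have hm : ∀ k, Measurable fun x => edist (z k x) 1 := fun k => by
      simp_rw [edist_dist]
      exact (stronglyMeasurable_dist_one (z k)).measurable.ennreal_ofReal
    have h : ∫⁻ x, ∑' k, edist (z k x) 1 ∂ν ≠ ∞ := by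
      rw [lintegral_tsum fun k => (hm k).aemeasurable]
      have h1 : ∀ k, ∫⁻ x, edist (z k x) 1 ∂ν = ENNReal.ofReal (gauge ν (z k)) := fun k => by
        simp_rw [edist_dist]
        exact (ofReal_integral_eq_lintegral_ofReal (integrable_dist_one ν (z k))
          (Eventually.of_forall fun x => dist_nonneg)).symm
      simp_rw [h1]
      exact hz.tsum_ofReal_ne_top
    filter_upwards [ae_lt_top (Measurable.tsum hm) h] with x hx using hx.ne
  obtain ⟨g, hg, hlim⟩ := exists_stronglyMeasurable_limit_of_tendsto_ae (μ := μ)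
    (f := fun n x => ∏ k ∈ Finset.range n, z k x)
    (fun n => (Finset.stronglyMeasurable_fun_prod _
      fun k _ => (z k).stronglyMeasurable).aestronglyMeasurable) (by
      filter_upwards [hfin] with x hx
      refine cauchySeq_tendsto_of_complete
        (cauchySeq_of_edist_le_of_tsum_ne_top (fun k => edist (z k x) 1) (fun n => ?_) hx)
      rw [Finset.prod_range_succ, edist_dist, edist_dist, dist_comm, ← circle_dist_inv_mul,
        inv_mul_cancel_left])
  have ht : Tendsto (fun n => ∏ k ∈ Finset.range n, z k) atTop
      (𝓝 (AEEqFun.mk g hg.aestronglyMeasurable : L0Circle μ)) := by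
    rw [tendsto_iff]
    intro A hA hAμ
    have : IsFiniteMeasure (μ.restrict A) := isFiniteMeasure_restrict.2 hAμ.ne
    refine tendstoInMeasure_of_tendsto_ae
      (fun n => (AEEqFun.stronglyMeasurable _).aestronglyMeasurable) (ae_restrict_of_ae ?_)
    filter_upwards [hlim, AEEqFun.coeFn_mk g hg.aestronglyMeasurable,
      ae_all_iff.2 fun n => coeFn_prod (Finset.range n) z] with x h1 h2 h3
    rw [h2]
    simpa only [h3] using h1
  refine ⟨_, ht, ?_⟩
  set f : L0Circle μ := AEEqFun.mk g hg.aestronglyMeasurable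
  have hprod : ∀ n, gauge ν (∏ k ∈ Finset.range n, z k) ≤ ∑' k, gauge ν (z k) := fun n => by
    refine le_trans ?_ (hz.sum_le_tsum (Finset.range n)
      fun k _ => integral_nonneg fun x => dist_nonneg)
    exact gauge_prod_le hν _ z
  refine le_of_forall_pos_lt_add fun ε hε => ?_
  have h1 : Tendsto (fun n => (∏ k ∈ Finset.range n, z k)⁻¹ * f) atTop (𝓝 1) := by
    simpa using ht.inv.mul_const f
  obtain ⟨n, hn⟩ := (h1.eventually (setOf_gauge_lt_mem_nhds_one hν hε)).exists
  have h2 := gauge_mul_le hν (∏ k ∈ Finset.range n, z k) ((∏ k ∈ Finset.range n, z k)⁻¹ * f)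
  rw [mul_inv_cancel_left] at h2
  exact h2.trans_lt (add_lt_add_of_le_of_lt (hprod n) hn)

end L0Circle

/-! ### Products of integer powers -/

/-- The homomorphism from the free abelian group on `ℕ`, written multiplicatively, which sends the
`s`-th generator to `a s`. -/
noncomputable def prodZPow {M : Type*} [CommGroup M] (a : ℕ → M) : Multiplicative (ℕ →₀ ℤ) →* M :=
  MonoidHom.mk' (fun x => x.toAdd.prod fun s n => a s ^ n) fun x y => by
    rw [toAdd_mul]
    exact Finsupp.prod_add_index' (fun s => zpow_zero _) fun s m n => zpow_add _ _ _

theorem prodZPow_single {M : Type*} [CommGroup M] (a : ℕ → M) (s : ℕ) :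
    prodZPow a (Multiplicative.ofAdd (Finsupp.single s 1)) = a s := by
  simp [prodZPow]

/-! ### Length functions -/

section Length

variable {G : Type*} [CommGroup G] {ℓ : G → ℝ}

theorem length_nonneg (h1 : ℓ 1 = 0) (hmul : ∀ g h, ℓ (g * h) ≤ ℓ g + ℓ h)
    (hinv : ∀ g, ℓ g⁻¹ = ℓ g) (g : G) : 0 ≤ ℓ g := by
  have := hmul g g⁻¹
  rw [mul_inv_cancel, h1, hinv] at this
  linarith

theorem length_zpow_le (h1 : ℓ 1 = 0) (hmul : ∀ g h, ℓ (g * h) ≤ ℓ g + ℓ h)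
    (hinv : ∀ g, ℓ g⁻¹ = ℓ g) (g : G) (n : ℤ) : ℓ (g ^ n) ≤ |(n : ℝ)| * ℓ g := by
  have hpow : ∀ k : ℕ, ℓ (g ^ k) ≤ k * ℓ g := fun k => by
    induction k with
    | zero => simp [h1]
    | succ k ih =>
      rw [pow_succ, Nat.cast_succ, add_mul, one_mul]
      exact (hmul _ _).trans (by linarith)
  obtain ⟨k, rfl | rfl⟩ := n.eq_nat_or_neg
  · simpa using hpow k
  · simpa [hinv] using hpow k

theorem length_prodZPow_le (h1 : ℓ 1 = 0) (hmul : ∀ g h, ℓ (g * h) ≤ ℓ g + ℓ h)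
    (hinv : ∀ g, ℓ g⁻¹ = ℓ g) (a : ℕ → G) (x : Multiplicative (ℕ →₀ ℤ)) :
    ℓ (prodZPow a x) ≤ x.toAdd.sum fun s n => |(n : ℝ)| * ℓ (a s) := by
  have hprod : ∀ (S : Finset ℕ) (b : ℕ → G), ℓ (∏ s ∈ S, b s) ≤ ∑ s ∈ S, ℓ (b s) := fun S b => by
    induction S using Finset.induction_on with
    | empty => simp [h1]
    | insert s S hs ih =>
      rw [Finset.prod_insert hs, Finset.sum_insert hs]
      exact (hmul _ _).trans (add_le_add_right ih _)
  exact (hprod _ _).trans (Finset.sum_le_sum fun s _ => length_zpow_le h1 hmul hinv _ _)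

/-- An element `g` of length less than `c ^ 2` is an infinite product of members of a dense
sequence whose lengths decrease geometrically. The factors are chosen greedily, the `k`-th one so
that the remainder `g / (a (s 0) ⋯ a (s k))` has length less than `(c / 2 ^ (k + 1)) ^ 2`. -/
theorem exists_seq_tendsto_prod [TopologicalSpace G] [IsTopologicalGroup G]
    (hmul : ∀ g h, ℓ (g * h) ≤ ℓ g + ℓ h) (hinv : ∀ g, ℓ g⁻¹ = ℓ g)
    (hbasis : (𝓝 (1 : G)).HasBasis (fun ε : ℝ => 0 < ε) fun ε => {g | ℓ g < ε})
    {a : ℕ → G} (ha : DenseRange a) {c : ℝ} (hc : 0 < c) {g : G} (hg : ℓ g < c ^ 2) :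
    ∃ s : ℕ → ℕ, (∀ k, ℓ (a (s k)) ≤ 2 * (c / 2 ^ k) ^ 2) ∧
      Tendsto (fun n => ∏ k ∈ Finset.range n, a (s k)) atTop (𝓝 g) := by
  have hpick : ∀ (r : G) (k : ℕ), ∃ s, ℓ (r * (a s)⁻¹) < (c / 2 ^ (k + 1)) ^ 2 := fun r k => by
    have h1 : {y : G | ℓ (r * y⁻¹) < (c / 2 ^ (k + 1)) ^ 2} ∈ 𝓝 r := by
      have : Tendsto (fun y : G => r * y⁻¹) (𝓝 r) (𝓝 1) := by
        have : Continuous fun y : G => r * y⁻¹ := by fun_prop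
        simpa using this.tendsto r
      exact this (hbasis.mem_of_mem (by positivity))
    obtain ⟨_, hs, s, rfl⟩ := mem_closure_iff_nhds.1 (ha r) _ h1
    exact ⟨s, hs⟩
  choose pick hpick using hpick
  let r : ℕ → G := fun n => Nat.rec g (fun k r => r * (a (pick r k))⁻¹) n
  have hr : ∀ k, r (k + 1) = r k * (a (pick (r k) k))⁻¹ := fun k => rfl
  have hrl : ∀ k, ℓ (r k) < (c / 2 ^ k) ^ 2 := fun k => by
    cases k with
    | zero => rwa [pow_zero, div_one]
    | succ k => exact hpick _ _
  refine ⟨fun k => pick (r k) k, fun k => ?_, ?_⟩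
  · have h1 : a (pick (r k) k) = r k * (r (k + 1))⁻¹ := by
      rw [hr, mul_inv, inv_inv, mul_inv_cancel_left]
    have h2 := hmul (r k) (r (k + 1))⁻¹
    rw [hinv] at h2
    have h3 : (c / 2 ^ (k + 1)) ^ 2 ≤ (c / 2 ^ k) ^ 2 := by
      gcongr
      · exact one_le_two
      · exact k.le_succ
    rw [h1]
    linarith [hrl k, hrl (k + 1)]
  · have hprod : ∀ n, ∏ k ∈ Finset.range n, a (pick (r k) k) = g * (r n)⁻¹ := fun n => by
      induction n with
      | zero => exact (mul_inv_cancel g).symm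
      | succ n ih => rw [Finset.prod_range_succ, ih, hr, mul_inv, inv_inv, mul_assoc]
    have hr1 : Tendsto r atTop (𝓝 1) := by
      rw [hbasis.tendsto_right_iff]
      intro ε hε
      have : Tendsto (fun k : ℕ => (c / 2 ^ k) ^ 2) atTop (𝓝 0) := by
        have : Tendsto (fun k : ℕ => c / 2 ^ k) atTop (𝓝 0) :=
          tendsto_const_nhds.div_atTop (tendsto_pow_atTop_atTop_of_one_lt one_lt_two)
        simpa using this.pow 2
      filter_upwards [this.eventually_lt_const hε] with k hk
      exact (hrl k).trans hk
    simp_rw [hprod]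
    simpa using hr1.inv.const_mul g

end Length

namespace L0Circle

/-! ### The open homomorphism onto `G` -/

/-- There are elements `ζ s` of `L⁰(X, U(1))` that are close to `1` when `w s` is small, while
`∏ ζ s ^ x s` is close to `1` only if the weighted `ℓ¹`-norm `∑ |x s| w s` is small. -/
theorem exists_seq_gauge {X : Type*} [MeasurableSpace X] [StandardBorelSpace X]
    {μ ν : Measure X} [IsProbabilityMeasure ν] [NullSingletonClass ν] (hν : ν ≪ μ)
    {w : ℕ → ℝ} (hw : ∀ s, 0 ≤ w s) :
    ∃ ζ : ℕ → L0Circle μ,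
      (∀ s (t : ℝ), 0 < t → w s ≤ 2 * t ^ 2 → gauge ν (ζ s) ≤ 3 * t) ∧
      ∀ x : Multiplicative (ℕ →₀ ℤ), 1 - Real.exp (-x.toAdd.sum fun s n => |(n : ℝ)| * w s) ≤
        gauge ν (prodZPow ζ x) := by
  obtain ⟨z, hz, hE⟩ := exists_circle_variables ν hw
  have hmk : ∀ s, ⇑(AEEqFun.mk (z s) (hz s).aestronglyMeasurable : L0Circle μ) =ᵐ[ν] z s :=
    fun s => hν.ae_le (AEEqFun.coeFn_mk _ _)
  have hcoe : Continuous fun a : Circle => (a : ℂ) := continuous_subtype_val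
  refine ⟨fun s => AEEqFun.mk (z s) (hz s).aestronglyMeasurable, fun s t ht hwt => ?_, fun x => ?_⟩
  · have h1 : ∫ ω, (z s ω : ℂ) ∂ν = (Real.exp (-w s) : ℝ) := by
      simpa using hE (Finsupp.single s 1)
    have hint : Integrable (fun ω => (z s ω : ℂ)) ν :=
      Integrable.of_bound (hcoe.comp_stronglyMeasurable (hz s)).aestronglyMeasurable 1
        (Eventually.of_forall fun ω => (Circle.norm_coe _).le)
    have h2 : ∫ ω, (z s ω : ℂ).re ∂ν = Real.exp (-w s) := by
      have := integral_re hint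
      simp only [RCLike.re_to_complex] at this
      rw [this, h1, Complex.ofReal_re]
    have h3 : gauge ν (AEEqFun.mk (z s) (hz s).aestronglyMeasurable : L0Circle μ) =
        ∫ ω, dist (z s ω) 1 ∂ν := by
      refine integral_congr_ae ?_
      filter_upwards [hmk s] with ω hω
      rw [hω]
    -- This is `2 t d ≤ t² + d²` for `d = dist a 1`, together with `d² = 2 (1 - Re a)`; it bounds
    -- the mean distance in terms of the expectation of `1 - Re (z s)`, which is at most `w s`.
    have h4 : ∀ a : Circle, dist a 1 ≤ t / 2 + (1 - (a : ℂ).re) / t := fun a => by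
      have h5 : dist a 1 ^ 2 = 2 * (1 - (a : ℂ).re) := by
        rw [circle_dist_eq, ← Complex.normSq_eq_norm_sq, Complex.normSq_sub, Circle.normSq_coe]
        simp
        ring
      rw [show t / 2 + (1 - (a : ℂ).re) / t = (t ^ 2 + dist a 1 ^ 2) / (2 * t) by
        rw [h5]; field_simp, le_div_iff₀ (by positivity)]
      nlinarith [sq_nonneg (t - dist a 1)]
    have hint' : Integrable (fun ω => (1 - (z s ω : ℂ).re) / t) ν :=
      ((integrable_const _).sub hint.re).div_const t
    have h6 : ∫ ω, (1 - (z s ω : ℂ).re) / t ∂ν = (1 - Real.exp (-w s)) / t := by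
      rw [integral_div, integral_sub (integrable_const _) (g := fun ω => (z s ω : ℂ).re) hint.re,
        h2]
      simp
    have h5 : ∫ ω, dist (z s ω) 1 ∂ν ≤ ∫ ω, (t / 2 + (1 - (z s ω : ℂ).re) / t) ∂ν := by
      refine integral_mono ?_ ((integrable_const _).add hint') fun ω => h4 _
      exact Integrable.of_bound ((hz s).dist stronglyMeasurable_const).aestronglyMeasurable 2
        (Eventually.of_forall fun x => by
          rw [Real.norm_of_nonneg dist_nonneg]; exact circle_dist_one_le_two _)
    rw [integral_add (integrable_const _) hint', h6] at h5
    simp only [integral_const, probReal_univ, smul_eq_mul, one_mul] at h5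
    have h8 := Real.add_one_le_exp (-w s)
    have h7 : (1 - Real.exp (-w s)) / t ≤ 2 * t := by
      rw [div_le_iff₀ ht]; nlinarith
    rw [h3]
    linarith
  · have h1 : ⇑(prodZPow (fun s => (AEEqFun.mk (z s) (hz s).aestronglyMeasurable : L0Circle μ)) x)
        =ᵐ[ν] fun ω => x.toAdd.prod fun s n => z s ω ^ n := by
      have h2 : ∀ᵐ ω ∂ν, ∀ s, ((AEEqFun.mk (z s) (hz s).aestronglyMeasurable : L0Circle μ) ^
          (x.toAdd s)) ω = z s ω ^ (x.toAdd s) := ae_all_iff.2 fun s => by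
        filter_upwards [hmk s, hν.ae_le (AEEqFun.coeFn_zpow
          (AEEqFun.mk (z s) (hz s).aestronglyMeasurable : L0Circle μ) (x.toAdd s))] with ω h3 h4
        rw [h4, Pi.pow_apply, h3]
      filter_upwards [h2, hν.ae_le (coeFn_prod x.toAdd.support fun s =>
        (AEEqFun.mk (z s) (hz s).aestronglyMeasurable : L0Circle μ) ^ (x.toAdd s))] with ω h3 h4
      exact h4.trans (Finset.prod_congr rfl fun s _ => h3 s)
    set y : X → Circle := fun ω => x.toAdd.prod fun s n => z s ω ^ n with hy
    set f := prodZPow (fun s => (AEEqFun.mk (z s) (hz s).aestronglyMeasurable : L0Circle μ)) x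
    have hf : ∫ ω, (f ω : ℂ) ∂ν =
        (Real.exp (-x.toAdd.sum fun s n => |(n : ℝ)| * w s) : ℝ) := by
      rw [← hE]
      refine integral_congr_ae ?_
      filter_upwards [h1] with ω hω
      rw [hω]
    have hint : Integrable (fun ω => (f ω : ℂ)) ν :=
      Integrable.of_bound (hcoe.comp_stronglyMeasurable f.stronglyMeasurable).aestronglyMeasurable 1
        (Eventually.of_forall fun ω => (Circle.norm_coe _).le)
    -- The mean distance dominates `|E[f] - 1|`.
    have h2 := norm_integral_le_integral_norm (μ := ν) fun ω => (f ω : ℂ) - 1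
    rw [integral_sub hint (integrable_const _), hf] at h2
    simp only [integral_const, probReal_univ, one_smul] at h2
    rw [← Complex.ofReal_one, ← Complex.ofReal_sub, Complex.norm_real, Real.norm_eq_abs,
      abs_sub_comm] at h2
    refine (le_abs_self _).trans (h2.trans (le_of_eq ?_))
    refine integral_congr_ae (Eventually.of_forall fun ω => ?_)
    simp only [circle_dist_eq, Circle.coe_one, Complex.ofReal_one]

/-- Every abelian Polish group is an open continuous homomorphic image of a closed subgroup of
`L⁰(X, U(1))`. -/
theorem exists_isOpenQuotientMap {X : Type*} [MeasurableSpace X] [StandardBorelSpace X]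
    (μ : Measure X) [SigmaFinite μ] [NullSingletonClass μ] [NeZero μ]
    (G : Type*) [CommGroup G] [TopologicalSpace G] [IsTopologicalGroup G] [PolishSpace G] :
    ∃ H : Subgroup (L0Circle μ), IsClosed (H : Set (L0Circle μ)) ∧
      ∃ φ : H →* G, IsOpenQuotientMap φ := by
  obtain ⟨ℓ, h1, hmul, hinv, hbasis⟩ := exists_length_hasBasis_nhds_one G
  have hν := toFinite_absolutelyContinuous μ
  have hμ := absolutelyContinuous_toFinite μ
  set ν := μ.toFinite
  have : NullSingletonClass ν := ⟨fun x => hν (measure_singleton x)⟩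
  have hgauge := hasBasis_nhds_one_gauge hν hμ
  set a := TopologicalSpace.denseSeq G
  have ha : DenseRange a := TopologicalSpace.denseRange_denseSeq G
  obtain ⟨ζ, hζ, hζx⟩ := exists_seq_gauge hν (w := fun s => ℓ (a s))
    fun s => length_nonneg h1 hmul hinv _
  have hcont : Tendsto (prodZPow a) (comap (prodZPow ζ) (𝓝 1)) (𝓝 1) := by
    refine ((hgauge.comap _).tendsto_iff hbasis).2 fun ε hε =>
      ⟨1 - Real.exp (-ε), by simpa using hε, fun x hx => ?_⟩
    refine (length_prodZPow_le h1 hmul hinv a x).trans_lt ?_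
    have h2 := (hζx x).trans_lt hx
    rw [sub_lt_sub_iff_left, Real.exp_lt_exp, neg_lt_neg_iff] at h2
    exact h2
  set H := (prodZPow ζ).range.topologicalClosure
  obtain ⟨φ, hφ, hφζ⟩ : ∃ φ : H →* G, Continuous φ ∧
      ∀ x (hx : prodZPow ζ x ∈ H), φ ⟨prodZPow ζ x, hx⟩ = prodZPow a x :=
    exists_continuous_extension_topologicalClosure _ _ hcont
  -- Elements of length less than `c ^ 2` have preimages at mean distance at most `6 c` from `1`:
  -- the factors of the lifted product contribute at most `3 (c / 2 ^ k)`. This gives surjectivity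
  -- (large `c`) and openness (small `c`).
  have hlift : ∀ c : ℝ, 0 < c → ∀ g : G, ℓ g < c ^ 2 →
      ∃ f : H, φ f = g ∧ gauge ν (f : L0Circle μ) ≤ 6 * c := by
    intro c hc g hg
    obtain ⟨s, hs, hsg⟩ := exists_seq_tendsto_prod hmul hinv hbasis ha hc hg
    have hle : ∀ k, gauge ν (ζ (s k)) ≤ 3 * (c / 2 ^ k) := fun k =>
      hζ _ _ (by positivity) (hs k)
    have hsum : HasSum (fun k : ℕ => 3 * (c / 2 ^ k)) (6 * c) := by
      have := (hasSum_geometric_two.mul_left (3 * c))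
      convert! this using 1
      · ext k; rw [one_div, inv_pow]; ring
      · ring
    have hsummable : Summable fun k => gauge ν (ζ (s k)) :=
      Summable.of_nonneg_of_le (fun k => integral_nonneg fun x => dist_nonneg) hle hsum.summable
    obtain ⟨f, hf, hfg⟩ := exists_tendsto_prod_of_summable_gauge hν hμ hsummable
    let x : ℕ → Multiplicative (ℕ →₀ ℤ) := fun n =>
      ∏ k ∈ Finset.range n, Multiplicative.ofAdd (Finsupp.single (s k) 1)
    have hxζ : ∀ n, prodZPow ζ (x n) = ∏ k ∈ Finset.range n, ζ (s k) := fun n => by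
      simp only [x, map_prod, prodZPow_single]
    have hxa : ∀ n, prodZPow a (x n) = ∏ k ∈ Finset.range n, a (s k) := fun n => by
      simp only [x, map_prod, prodZPow_single]
    have hxH : ∀ n, prodZPow ζ (x n) ∈ H := fun n => subset_closure ⟨x n, rfl⟩
    simp_rw [← hxζ] at hf
    simp_rw [← hxa] at hsg
    have hfH : f ∈ H := (Subgroup.isClosed_topologicalClosure _).mem_of_tendsto hf
      (Eventually.of_forall hxH)
    refine ⟨⟨f, hfH⟩, ?_, hfg.trans ?_⟩
    · have h2 : Tendsto (fun n => (⟨prodZPow ζ (x n), hxH n⟩ : H)) atTop (𝓝 ⟨f, hfH⟩) :=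
        tendsto_subtype_rng.2 hf
      have h3 := (hφ.tendsto _).comp h2
      simp only [Function.comp_def, hφζ] at h3
      exact tendsto_nhds_unique h3 hsg
    · rw [← hsum.tsum_eq]
      exact hsummable.tsum_le_tsum hle hsum.summable
  refine ⟨H, Subgroup.isClosed_topologicalClosure _, φ, fun g => ?_, hφ, ?_⟩
  · have h2 := length_nonneg h1 hmul hinv g
    obtain ⟨f, hf, -⟩ := hlift (ℓ g + 1) (by linarith) g (by nlinarith)
    exact ⟨f, hf⟩
  · rw [IsTopologicalGroup.isOpenMap_iff_nhds_one]
    intro U hU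
    rw [mem_map, nhds_subtype_eq_comap, OneMemClass.coe_one, (hgauge.comap _).mem_iff] at hU
    obtain ⟨δ, hδ, hδU⟩ := hU
    refine mem_of_superset (hbasis.mem_of_mem (i := (δ / 12) ^ 2) (by positivity)) fun g hg => ?_
    obtain ⟨f, rfl, hf⟩ := hlift (δ / 12) (by positivity) g hg
    exact hδU (show gauge ν (f : L0Circle μ) < δ by linarith)

end L0Circle

theorem mainTheorem7 {X : Type*} [MeasurableSpace X] [StandardBorelSpace X]
    (μ : Measure X) [SigmaFinite μ] [NullSingletonClass μ] [NeZero μ]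
    (G : Type*) [CommGroup G] [TopologicalSpace G] [IsTopologicalGroup G] [PolishSpace G] :
    (∃ F : Subgroup (L0Circle μ), IsClosed (F : Set (L0Circle μ)) ∧
      ∃ K : Subgroup (L0Circle μ ⧸ F), IsClosed (K : Set (L0Circle μ ⧸ F)) ∧
        Nonempty (G ≃ₜ* K)) ∧
    (∃ H : Subgroup (L0Circle μ), IsClosed (H : Set (L0Circle μ)) ∧
      ∃ N : Subgroup H, IsClosed (N : Set H) ∧ Nonempty (G ≃ₜ* (H ⧸ N))) := by
  obtain ⟨H, hH, φ, hφ⟩ := L0Circle.exists_isOpenQuotientMap μ G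
  exact subquotient_of_isOpenQuotientMap hH hφ
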